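/- **Theorem 4.3.** Let $n\ge 2$, $t_0\in\mathbb R$, $\gamma\ge 0$, and let $a_0,a_1,\dots,a_n$ be real-valued continuous functions on $[t_0,+\infty)$. Consider the equation $$y'+\sum_{k=0}^{n}a_k(t)\,y^k=0,\qquad t\ge t_0, \tag{1.1}$$ and set $$I_\gamma(t)=\gamma\exp\Big\{-\int_{t_0}^{t}a_1(\tau)\,d\tau\Big\}+\int_{t_0}^{t}\exp\Big\{-\int_{\tau}^{t}a_1(s)\,ds\Big\}|a_0(\tau)|\,d\tau,\qquad t\ge t_0 .$$ A finite or infinite sequence $t_0<t_1<\dots$ in $[t_0,+\infty]$ is called usable for $[t_0,+\infty)$ if it is finite and its maximum is $+\infty$, or it is infinite and $\lim_{k\to\infty}t_k=+\infty$. Assume: (C) $a_k(t)\ge 0$ for $k=2,\dots,n$ and $t\ge t_0$. (D) For some usable sequence $\{t_l\}$ for $[t_0,+\infty)$, $$\int_{t_l}^{t}\exp\Big\{\int_{t_l}^{\tau}\Big[a_1(s)-a_2(s)\int_{t_l}^{s}\exp\Big\{-\int_{\xi}^{s}a_1(\zeta)\,d\zeta\Big\}a_0(\xi)\,d\xi\Big]ds\Big\}a_0(\tau)\,d\tau\le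 0$$ for all $t\in[t_l,t_{l+1})$ and all $l=1,2,\dots$ for which $t_{l+1}$ is a term of the sequence. (E) For all $t\ge t_0$, $$\int_{t_0}^{t}\exp\Big\{\int_{t_0}^{\tau}\Big[\sum_{k=2}^{n}a_k(s)I_\gamma^{k-1}(s)+a_1(s)\Big]ds\Big\}a_0(\tau)\,d\tau\le 0 .$$ Then every solution $y$ of (1.1) with $y(t_0)=\gamma$ exists on $[t_0,+\infty)$ and satisfies $0\le y(t)\le I_\gamma(t)$ for all $t\ge t_0$. That is, (1.1) has a solution on $[t_0,+\infty)$ with value $\gamma$ at $t_0$, and every solution with value $\gamma$ at $t_0$ on a nondegenerate interval with left endpoint $t_0$ (included) extends to a solution on $[t_0,+\infty)$ with $0\le y\le I_\gamma$ there. -/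

import Mathlib

open Set Filter Topology

/-- `y` is a solution on the interval `J` of the polynomial differential equation
`y' + ∑_{k=0}^n a_k(t) y^k = 0`; at endpoints belonging to `J` the derivative is one-sided. -/
def IsPolySolutionOn (n : ℕ) (a : ℕ → ℝ → ℝ) (J : Set ℝ) (y : ℝ → ℝ) : Prop :=
  ∀ t ∈ J, HasDerivWithinAt y (-∑ k ∈ Finset.range (n + 1), a k t * y t ^ k) J t

/-- A finite or infinite sequence `t₀ = T 0 < T 1 < …` in `[t₀, τ₀]` is usable for `[t₀, τ₀)`, where
`τ₀ ≤ +∞`. Its index set is `{k : ℕ | k ≤ N}`, so `N = ⊤` means that the sequence is infinite;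
values of `T` at other indices play no role. A finite usable sequence has maximum `τ₀`
(which may be `+∞`), an infinite one tends to `τ₀`. -/
structure IsUsableSequence (t₀ : ℝ) (τ₀ : EReal) (N : ℕ∞) (T : ℕ → EReal) : Prop where
  start : T 0 = (t₀ : EReal)
  lt_succ : ∀ k : ℕ, ((k + 1 : ℕ) : ℕ∞) ≤ N → T k < T (k + 1)
  mem_Icc : ∀ k : ℕ, (k : ℕ∞) ≤ N → T k ∈ Icc (t₀ : EReal) τ₀
  finite_case : N ≠ ⊤ → IsGreatest (T '' {k : ℕ | (k : ℕ∞) ≤ N}) τ₀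
  infinite_case : N = ⊤ → Tendsto T atTop (𝓝 τ₀)

/-- `I_γ(t) = γ exp(-∫_{t₀}^t a₁) + ∫_{t₀}^t exp(-∫_τ^t a₁) |a₀(τ)| dτ`. -/
noncomputable def upperI (a : ℕ → ℝ → ℝ) (t₀ γ t : ℝ) : ℝ :=
  γ * Real.exp (-∫ τ in t₀..t, a 1 τ) +
    ∫ τ in t₀..t, Real.exp (-∫ s in τ..t, a 1 s) * |a 0 τ|

/-- The integral from `r` to `t` in the Riccati-type condition. -/
noncomputable def riccatiIntegral (a : ℕ → ℝ → ℝ) (r t : ℝ) : ℝ :=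
  ∫ τ in r..t,
    Real.exp (∫ s in r..τ,
      (a 1 s - a 2 s * ∫ ξ in r..s, Real.exp (-∫ ζ in ξ..s, a 1 ζ) * a 0 ξ)) * a 0 τ

/-!
# Global nonnegative solutions of a polynomial differential equation

Write `A(t) = ∫_{t₀}^t a₁` and `u = e^A y`; then `u' = -e^A (a₀ + ∑_{k ≥ 2} a_k y^k)`. Replacing
`y` in the sum by its truncation `c` to `[0, I_γ(t)]` makes the right-hand side bounded and
Lipschitz in `u`, locally uniformly in `t`, so the modified problem has a global solution
(`exists_forall_hasDerivAt_of_bounded_of_lipschitz`). The truncation turns out to be inactive.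

* Since `a_k ≥ 0` and `c ≥ 0`, `u' ≤ e^A |a₀|`, which integrates to `y ≤ I_γ`. Hence `c` is the
  positive part of `y`.
* Therefore `u' = -(e^A a₀ + P u)` with `P = ∑_{k ≥ 2} a_k c^{k-1} ≤ Q = ∑_{k ≥ 2} a_k I_γ^{k-1}`.
  Condition (E) says that `F = ∫ e^{A + ∫ Q} a₀ ≤ 0`. As
  `(u e^{∫ P})' = -F' e^{∫ P - ∫ Q}` and the last exponential is nonincreasing, an integration by
  parts gives `u e^{∫ P} ≥ γ ≥ 0` (`nonneg_of_integral_nonpos`).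

So `0 ≤ y ≤ I_γ`, and `y` solves the original equation (`exists_solution_of_continuous`). Any other
solution with the same initial value agrees with it by Grönwall's inequality
(`IsPolySolutionOn.eqOn_Icc`). Working with the truncated equation, rather than up to a first zero
of `y`, treats `γ = 0` like `γ > 0`; this argument rests on (C) and (E) alone.
-/

/-! ### Global existence for bounded Lipschitz fields -/

/-- Picard-Lindelöf on the whole line: because the field is bounded, one step of Picard-Lindelöf
covers `[t₀ - R, t₀ + R]` for every `R`, and the local solutions agree where they overlap. -/

theorem exists_forall_hasDerivAt_of_bounded_of_lipschitz {E : Type*} [NormedAddCommGroup E]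
    [NormedSpace ℝ E] [CompleteSpace E] {g : ℝ → E → E} {L K : ℝ → ℝ}
    (hL : Continuous L) (hK : Continuous K) (hg : ∀ x, Continuous fun t ↦ g t x)
    (hbound : ∀ t x, ‖g t x‖ ≤ L t) (hlip : ∀ t x y, ‖g t x - g t y‖ ≤ K t * ‖x - y‖)
    (t₀ : ℝ) (u₀ : E) :
    ∃ u : ℝ → E, u t₀ = u₀ ∧ ∀ t, HasDerivAt u (g t (u t)) t := by
  have lip : ∀ c d : ℝ, ∃ C : NNReal, ∀ t ∈ Icc c d, LipschitzWith C (g t) := by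
    intro c d
    obtain ⟨C, hC⟩ := isCompact_Icc.exists_bound_of_continuousOn (hK.continuousOn (s := Icc c d))
    refine ⟨C.toNNReal, fun t ht ↦ LipschitzWith.of_dist_le_mul fun x y ↦ ?_⟩
    rw [dist_eq_norm, dist_eq_norm]
    refine (hlip t x y).trans ?_
    gcongr
    exact ((le_abs_self _).trans (hC t ht)).trans (Real.le_coe_toNNReal C)
  have loc : ∀ m : ℕ, ∃ u : ℝ → E, u t₀ = u₀ ∧
      ∀ t ∈ Ioo (t₀ - (m + 1)) (t₀ + (m + 1)), HasDerivAt u (g t (u t)) t := by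
    intro m
    obtain ⟨C, hC⟩ := lip (t₀ - (m + 1)) (t₀ + (m + 1))
    obtain ⟨B, hB⟩ := isCompact_Icc.exists_bound_of_continuousOn
      (hL.continuousOn (s := Icc (t₀ - (m + 1)) (t₀ + (m + 1))))
    have hm : (0 : ℝ) ≤ m := m.cast_nonneg
    have hpl : IsPicardLindelof g (tmin := t₀ - (m + 1)) (tmax := t₀ + (m + 1))
        ⟨t₀, by constructor <;> linarith⟩ u₀ (B.toNNReal * (m + 1)) 0 B.toNNReal C :=
      { lipschitzOnWith := fun t ht ↦ (hC t ht).lipschitzOnWith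
        continuousOn := fun x _ ↦ (hg x).continuousOn
        norm_le := fun t ht x _ ↦
          ((hbound t x).trans ((le_abs_self _).trans (hB t ht))).trans (Real.le_coe_toNNReal B)
        mul_max_le := by simp }
    obtain ⟨u, h0, hu⟩ := hpl.exists_eq_forall_mem_Icc_hasDerivWithinAt₀
    exact ⟨u, h0, fun t ht ↦ (hu t (Ioo_subset_Icc_self ht)).hasDerivAt (Icc_mem_nhds ht.1 ht.2)⟩
  choose u h0 hu using loc
  -- Solutions on nested intervals agree, so `t ↦ u ⌈|t - t₀|⌉₊ t` is locally one of them.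
  have mono : ∀ m k : ℕ, m ≤ k → EqOn (u m) (u k) (Ioo (t₀ - (m + 1)) (t₀ + (m + 1))) := by
    intro m k hmk
    obtain ⟨C, hC⟩ := lip (t₀ - (m + 1)) (t₀ + (m + 1))
    have hm : (0 : ℝ) ≤ m := m.cast_nonneg
    have hmk' : (m : ℝ) ≤ k := by exact_mod_cast hmk
    refine ODE_solution_unique_of_mem_Ioo (v := g) (s := fun _ ↦ univ) (K := C) (t₀ := t₀)
      (fun t ht ↦ (hC t (Ioo_subset_Icc_self ht)).lipschitzOnWith)
      (by constructor <;> linarith) (fun t ht ↦ ⟨hu m t ht, mem_univ _⟩)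
      (fun t ht ↦ ⟨hu k t ?_, mem_univ _⟩) ((h0 m).trans (h0 k).symm)
    exact ⟨by linarith [ht.1], by linarith [ht.2]⟩
  have mem : ∀ t, t ∈ Ioo (t₀ - ((⌈|t - t₀|⌉₊ : ℕ) + 1 : ℝ)) (t₀ + ((⌈|t - t₀|⌉₊ : ℕ) + 1 : ℝ)) := by
    intro t
    have h := Nat.le_ceil |t - t₀|
    constructor <;> linarith [abs_le.1 (le_refl |t - t₀|)]
  refine ⟨fun t ↦ u ⌈|t - t₀|⌉₊ t, h0 _, fun t ↦ ?_⟩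
  refine (hu _ t (mem t)).congr_of_eventuallyEq ?_
  filter_upwards [Ioo_mem_nhds (mem t).1 (mem t).2] with s hs
  rcases le_total ⌈|s - t₀|⌉₊ ⌈|t - t₀|⌉₊ with h | h
  · exact mono _ _ h (mem s)
  · exact (mono _ _ h hs).symm

/-- A truncated power `x ↦ (max 0 (min x M))ᵏ` is Lipschitz. -/
theorem abs_clamp_pow_sub_le {M : ℝ} (hM : 0 ≤ M) (k : ℕ) (x y : ℝ) :
    |max 0 (min x M) ^ k - max 0 (min y M) ^ k| ≤ k * M ^ (k - 1) * |x - y| := by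
  have hc : ∀ z, |max 0 (min z M)| ≤ M := fun z ↦ by
    rw [abs_of_nonneg (le_max_left _ _)]
    exact max_le hM (min_le_right _ _)
  have h1 : |max 0 (min x M) - max 0 (min y M)| ≤ |x - y| := by
    refine (abs_max_sub_max_le_max _ _ _ _).trans ?_
    simpa using abs_min_sub_min_le_max x M y M
  calc _ ≤ _ := abs_pow_sub_pow_le _ _ _
    _ ≤ |x - y| * k * M ^ (k - 1) := by
        gcongr
        exact max_le (hc x) (hc y)
    _ = _ := by ring

/-! ### Integrals, comparison and integrating factors -/

theorem hasDerivAt_integral {f : ℝ → ℝ} (hf : Continuous f) (c t : ℝ) :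
    HasDerivAt (fun t ↦ ∫ s in c..t, f s) (f t) t :=
  (hf.integral_hasStrictDerivAt c t).hasDerivAt

/-- The value at the initial point bounds a function with nonnegative derivative from below. -/
theorem le_of_hasDerivAt_nonneg {f f' : ℝ → ℝ} {t₀ t : ℝ}
    (hf : ∀ s, t₀ ≤ s → HasDerivAt f (f' s) s) (h0 : ∀ s, t₀ ≤ s → 0 ≤ f' s) (ht : t₀ ≤ t) : f t₀ ≤ f t := by
  refine monotoneOn_of_hasDerivWithinAt_nonneg (convex_Ici t₀)
    (fun s hs ↦ (hf s hs).continuousAt.continuousWithinAt)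
    (fun s hs ↦ (hf s (interior_subset hs)).hasDerivWithinAt) (fun s hs ↦ h0 s ?_) self_mem_Ici ht ht
  exact interior_subset hs

/-- `I_γ` with its integrating factor taken out. -/
theorem upperI_eq {b : ℕ → ℝ → ℝ} (hb1 : Continuous (b 1)) (t₀ γ t : ℝ) :
    upperI b t₀ γ t = Real.exp (-∫ s in t₀..t, b 1 s) *
      (γ + ∫ τ in t₀..t, Real.exp (∫ s in t₀..τ, b 1 s) * |b 0 τ|) := by
  have key : ∀ τ, Real.exp (-∫ s in τ..t, b 1 s) * |b 0 τ| = Real.exp (-∫ s in t₀..t, b 1 s) *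
      (Real.exp (∫ s in t₀..τ, b 1 s) * |b 0 τ|) := by
    intro τ
    rw [← mul_assoc, ← Real.exp_add, ← intervalIntegral.integral_interval_sub_left
      (hb1.intervalIntegrable t₀ t) (hb1.intervalIntegrable t₀ τ)]
    ring_nf
  simp only [upperI, key, intervalIntegral.integral_const_mul]
  ring

/-- The comparison behind condition (E): a forcing term whose weighted integral is nonpositive for
the larger coefficient `Q` keeps solutions of the linear equation with coefficient `P ≤ Q`
nonnegative. -/
theorem nonneg_of_integral_nonpos {u b A P Q : ℝ → ℝ} {t₀ t : ℝ} (hb : Continuous b)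
    (hA : Continuous A) (hP : Continuous P) (hQ : Continuous Q)
    (hu : ∀ t, t₀ ≤ t → HasDerivAt u (-(Real.exp (A t) * b t + P t * u t)) t) (hu0 : 0 ≤ u t₀)
    (hPQ : ∀ t, t₀ ≤ t → P t ≤ Q t)
    (hE : ∀ t, t₀ ≤ t → ∫ τ in t₀..t, Real.exp (A τ + ∫ s in t₀..τ, Q s) * b τ ≤ 0)
    (ht : t₀ ≤ t) : 0 ≤ u t := by
  have hQc : Continuous fun t ↦ ∫ s in t₀..t, Q s :=
    continuous_iff_continuousAt.2 fun t ↦ (hasDerivAt_integral hQ t₀ t).continuousAt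
  have hFc : Continuous fun τ ↦ Real.exp (A τ + ∫ s in t₀..τ, Q s) * b τ := by fun_prop
  set F : ℝ → ℝ := fun t ↦ ∫ τ in t₀..t, Real.exp (A τ + ∫ s in t₀..τ, Q s) * b τ with hF
  have hp := hasDerivAt_integral hP t₀
  have hq := hasDerivAt_integral hQ t₀
  -- The sum of `u e^{∫P}` and `F e^{∫P-∫Q}` has derivative `F (P - Q) e^{∫P-∫Q} ≥ 0`.
  have hw : ∀ t, t₀ ≤ t → HasDerivAt (fun t ↦ u t * Real.exp (∫ s in t₀..t, P s) +
      F t * Real.exp ((∫ s in t₀..t, P s) - ∫ s in t₀..t, Q s))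
      (F t * (P t - Q t) * Real.exp ((∫ s in t₀..t, P s) - ∫ s in t₀..t, Q s)) t := by
    intro t ht
    have hFd : HasDerivAt F _ t := hasDerivAt_integral hFc t₀ t
    refine (((hu t ht).mul (hp t).exp).add (hFd.mul ((hp t).sub (hq t)).exp)).congr_deriv ?_
    simp only [Pi.sub_apply, Real.exp_add, Real.exp_sub]
    field_simp
    ring
  have h := le_of_hasDerivAt_nonneg hw (fun s hs ↦ mul_nonneg
    (mul_nonneg_of_nonpos_of_nonpos (hE s hs) (sub_nonpos.2 (hPQ s hs))) (Real.exp_pos _).le) ht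
  have h2 : F t * Real.exp ((∫ s in t₀..t, P s) - ∫ s in t₀..t, Q s) ≤ 0 :=
    mul_nonpos_of_nonpos_of_nonneg (hE t ht) (Real.exp_pos _).le
  simp only [hF, intervalIntegral.integral_same, Real.exp_zero, mul_one, zero_mul, add_zero] at h h2
  exact (mul_nonneg_iff_of_pos_right (Real.exp_pos (∫ s in t₀..t, P s))).1 (by linarith)

/-! ### The solution of the truncated equation -/

theorem sum_range_succ_eq_add_sum_Icc {n : ℕ} (hn : 2 ≤ n) (f : ℕ → ℝ) :
    ∑ k ∈ Finset.range (n + 1), f k = f 0 + f 1 + ∑ k ∈ Finset.Icc 2 n, f k := by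
  rw [Finset.range_eq_Ico, ← Finset.sum_Ico_consecutive f (Nat.zero_le 2) (by lia : 2 ≤ n + 1)]
  congr 1
  simp [Finset.sum_range_succ]

/-- Existence and the bounds `0 ≤ y ≤ I_γ` when the coefficients are continuous on all of `ℝ`, which
costs no generality: continuous functions on `[t₀, ∞)` extend to constants on the left. -/
theorem exists_solution_of_continuous {n : ℕ} (hn : 2 ≤ n) {b : ℕ → ℝ → ℝ} {t₀ γ : ℝ}
    (hb : ∀ k ≤ n, Continuous (b k)) (hγ : 0 ≤ γ)
    (hC : ∀ k, 2 ≤ k → k ≤ n → ∀ t, t₀ ≤ t → 0 ≤ b k t)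
    (hE : ∀ t, t₀ ≤ t →
      ∫ τ in t₀..t, Real.exp (∫ s in t₀..τ,
        ((∑ k ∈ Finset.Icc 2 n, b k s * upperI b t₀ γ s ^ (k - 1)) + b 1 s)) * b 0 τ ≤ 0) :
    ∃ y : ℝ → ℝ, y t₀ = γ ∧ IsPolySolutionOn n b (Ici t₀) y ∧
      ∀ t, t₀ ≤ t → 0 ≤ y t ∧ y t ≤ upperI b t₀ γ t := by
  have hb0 := hb 0 (by lia)
  have hb1 := hb 1 (by lia)
  have hbk : ∀ k ∈ Finset.Icc 2 n, Continuous (b k) := fun k hk ↦ hb k (Finset.mem_Icc.1 hk).2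
  set A : ℝ → ℝ := fun t ↦ ∫ s in t₀..t, b 1 s with hAdef
  have hA : ∀ t, HasDerivAt A (b 1 t) t := hasDerivAt_integral hb1 t₀
  have hAc : Continuous A := continuous_iff_continuousAt.2 fun t ↦ (hA t).continuousAt
  have hA0 : A t₀ = 0 := intervalIntegral.integral_same
  set G : ℝ → ℝ := fun t ↦ γ + ∫ τ in t₀..t, Real.exp (A τ) * |b 0 τ| with hGdef
  have hG : ∀ t, HasDerivAt G (Real.exp (A t) * |b 0 t|) t := fun t ↦
    (hasDerivAt_integral (by fun_prop) t₀ t).const_add γ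
  have hGc : Continuous G := continuous_iff_continuousAt.2 fun t ↦ (hG t).continuousAt
  have hG0 : G t₀ = γ := by simp [hGdef]
  have hI : ∀ t, upperI b t₀ γ t = Real.exp (-A t) * G t := upperI_eq hb1 t₀ γ
  have hIc : Continuous fun t ↦ upperI b t₀ γ t := by simp only [hI]; fun_prop
  have hInn : ∀ t, t₀ ≤ t → 0 ≤ upperI b t₀ γ t := fun t ht ↦ by
    rw [hI]
    have := le_of_hasDerivAt_nonneg (fun s _ ↦ hG s) (fun s _ ↦ by positivity) ht
    exact mul_nonneg (Real.exp_pos _).le (by linarith)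
  set M : ℝ → ℝ := fun t ↦ |upperI b t₀ γ t| with hMdef
  have hMc : Continuous M := hIc.abs
  -- `c t x` is `y = e^{-A} x` truncated to `[0, I_γ]`; the absolute value in `M` keeps the
  -- truncation meaningful for `t < t₀`, where `I_γ` may be negative.
  set c : ℝ → ℝ → ℝ := fun t x ↦ max 0 (min (Real.exp (-A t) * x) (M t)) with hcdef
  have hc0 : ∀ t x, 0 ≤ c t x := fun t x ↦ le_max_left _ _
  have hcM : ∀ t x, c t x ≤ M t := fun t x ↦ max_le (abs_nonneg _) (min_le_right _ _)
  obtain ⟨u, hu0, hu⟩ := exists_forall_hasDerivAt_of_bounded_of_lipschitz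
    (g := fun t x ↦ -(Real.exp (A t) * (b 0 t + ∑ k ∈ Finset.Icc 2 n, b k t * c t x ^ k)))
    (L := fun t ↦ Real.exp (A t) * (|b 0 t| + ∑ k ∈ Finset.Icc 2 n, |b k t| * M t ^ k))
    (K := fun t ↦ ∑ k ∈ Finset.Icc 2 n, |b k t| * (k * M t ^ (k - 1)))
    (by fun_prop (disch := assumption)) (by fun_prop (disch := assumption))
    (fun x ↦ by fun_prop (disch := assumption))
    (fun t x ↦ by
      rw [norm_neg, norm_mul, Real.norm_of_nonneg (Real.exp_pos _).le]
      gcongr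
      refine (norm_add_le _ _).trans (add_le_add le_rfl ((norm_sum_le _ _).trans ?_))
      gcongr with k hk
      rw [norm_mul, Real.norm_eq_abs, Real.norm_of_nonneg (pow_nonneg (hc0 t x) k)]
      gcongr
      exact hcM t x)
    (fun t x y ↦ by
      have : -(Real.exp (A t) * (b 0 t + ∑ k ∈ Finset.Icc 2 n, b k t * c t x ^ k)) -
          -(Real.exp (A t) * (b 0 t + ∑ k ∈ Finset.Icc 2 n, b k t * c t y ^ k)) =
          -(Real.exp (A t) * ∑ k ∈ Finset.Icc 2 n, b k t * (c t x ^ k - c t y ^ k)) := by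
        simp only [mul_sub, Finset.sum_sub_distrib]
        ring
      rw [this, norm_neg, norm_mul, Real.norm_of_nonneg (Real.exp_pos _).le]
      calc _ ≤ Real.exp (A t) * ∑ k ∈ Finset.Icc 2 n, |b k t| * (k * M t ^ (k - 1) *
            |Real.exp (-A t) * x - Real.exp (-A t) * y|) := by
            gcongr
            refine (norm_sum_le _ _).trans ?_
            gcongr with k hk
            rw [norm_mul, Real.norm_eq_abs, Real.norm_eq_abs]
            gcongr
            exact abs_clamp_pow_sub_le (abs_nonneg _) k _ _
        _ = _ := by
            rw [← mul_sub, abs_mul, abs_of_pos (Real.exp_pos _), Real.exp_neg, Finset.mul_sum,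
              Finset.sum_mul]
            refine Finset.sum_congr rfl fun k _ ↦ ?_
            rw [Real.norm_eq_abs]
            field_simp) t₀ γ
  have huc : Continuous u := continuous_iff_continuousAt.2 fun t ↦ (hu t).continuousAt
  have hle : ∀ t, t₀ ≤ t → Real.exp (-A t) * u t ≤ upperI b t₀ γ t := by
    intro t ht
    rw [hI]
    have h := le_of_hasDerivAt_nonneg (fun s _ ↦ (hG s).sub (hu s)) (fun s hs ↦ by
      have hsum : 0 ≤ ∑ k ∈ Finset.Icc 2 n, b k s * c s (u s) ^ k :=
        Finset.sum_nonneg fun k hk ↦ mul_nonneg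
          (hC k (Finset.mem_Icc.1 hk).1 (Finset.mem_Icc.1 hk).2 s hs) (pow_nonneg (hc0 _ _) _)
      have : 0 ≤ |b 0 s| + b 0 s := by linarith [neg_abs_le (b 0 s)]
      have := mul_nonneg (Real.exp_pos (A s)).le (add_nonneg this hsum)
      linarith) ht
    simp only [Pi.sub_apply, hG0, hu0, sub_self, sub_nonneg] at h
    gcongr
  have hcu : Continuous fun t ↦ c t (u t) := by fun_prop
  have hcy : ∀ t, t₀ ≤ t → c t (u t) = max 0 (Real.exp (-A t) * u t) := by
    intro t ht
    simp only [hcdef]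
    rw [min_eq_left ((hle t ht).trans (le_abs_self _))]
  have hnn : ∀ t, t₀ ≤ t → 0 ≤ u t := by
    intro t ht
    refine nonneg_of_integral_nonpos (A := A) (b := b 0)
      (P := fun t ↦ ∑ k ∈ Finset.Icc 2 n, b k t * c t (u t) ^ (k - 1))
      (Q := fun t ↦ ∑ k ∈ Finset.Icc 2 n, b k t * upperI b t₀ γ t ^ (k - 1)) hb0 hAc
      (by fun_prop (disch := assumption)) (by fun_prop (disch := assumption))
      (fun s hs ↦ (hu s).congr_deriv ?_) (hu0 ▸ hγ) (fun s hs ↦ ?_) (fun s hs ↦ ?_) ht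
    · rw [mul_add, Finset.mul_sum, Finset.sum_mul]
      congr 2
      refine Finset.sum_congr rfl fun k hk ↦ ?_
      obtain ⟨j, rfl⟩ := Nat.exists_eq_add_of_le (Finset.mem_Icc.1 hk).1
      have hj : 2 + j - 1 = j + 1 := by lia
      rw [hcy s hs, hj]
      -- `c^k e^A = c^{k-1} u` for `k ≥ 2`: either `c = y`, or both sides vanish.
      rcases le_total 0 (Real.exp (-A s) * u s) with h | h
      · rw [max_eq_right h, add_comm 2 j, pow_succ _ (j + 1), Real.exp_neg]
        field_simp
      · rw [max_eq_left h]
        simp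
    · refine Finset.sum_le_sum fun k hk ↦ mul_le_mul_of_nonneg_left ?_
        (hC k (Finset.mem_Icc.1 hk).1 (Finset.mem_Icc.1 hk).2 s hs)
      exact pow_le_pow_left₀ (hc0 _ _) ((hcM _ _).trans_eq (abs_of_nonneg (hInn s hs))) _
    · convert hE s hs using 5 with τ
      rw [intervalIntegral.integral_add, add_comm]
      · exact Continuous.intervalIntegrable (by fun_prop (disch := assumption)) _ _
      · exact hb1.intervalIntegrable _ _
  refine ⟨fun t ↦ Real.exp (-A t) * u t, by simp [hA0, hu0], fun t ht ↦ ?_,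
    fun t ht ↦ ⟨mul_nonneg (Real.exp_pos _).le (hnn t ht), hle t ht⟩⟩
  refine (((hA t).neg.exp.mul (hu t)).congr_deriv ?_).hasDerivWithinAt
  have hy : 0 ≤ Real.exp (-A t) * u t := mul_nonneg (Real.exp_pos _).le (hnn t ht)
  rw [hcy t ht, max_eq_right hy, sum_range_succ_eq_add_sum_Icc hn]
  simp only [Pi.neg_apply, Real.exp_neg]
  field_simp
  ring

/-! ### Uniqueness -/

theorem IsPolySolutionOn.mono {n : ℕ} {a : ℕ → ℝ → ℝ} {J J' : Set ℝ} {y : ℝ → ℝ}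
    (hy : IsPolySolutionOn n a J y) (h : J' ⊆ J) : IsPolySolutionOn n a J' y :=
  fun t ht ↦ (hy t (h ht)).mono h

theorem IsPolySolutionOn.eqOn_Icc {n : ℕ} {a : ℕ → ℝ → ℝ} {t₀ t₁ : ℝ} {y z : ℝ → ℝ}
    (ha : ∀ k ≤ n, ContinuousOn (a k) (Icc t₀ t₁)) (hy : IsPolySolutionOn n a (Icc t₀ t₁) y)
    (hz : IsPolySolutionOn n a (Icc t₀ t₁) z) (h0 : y t₀ = z t₀) : EqOn y z (Icc t₀ t₁) := by
  have hyc : ContinuousOn y (Icc t₀ t₁) := fun t ht ↦ (hy t ht).continuousWithinAt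
  have hzc : ContinuousOn z (Icc t₀ t₁) := fun t ht ↦ (hz t ht).continuousWithinAt
  have hac : ∀ k ∈ Finset.range (n + 1), ContinuousOn (a k) (Icc t₀ t₁) := fun k hk ↦
    ha k (Nat.lt_succ_iff.1 (Finset.mem_range.1 hk))
  have hKc : ContinuousOn (fun t ↦ ∑ k ∈ Finset.range (n + 1),
      |a k t| * (k * max |y t| |z t| ^ (k - 1))) (Icc t₀ t₁) :=
    continuousOn_finsetSum _ fun k hk ↦ (hac k hk).abs.mul
      (continuousOn_const.mul ((hyc.abs.sup hzc.abs).pow _))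
  obtain ⟨K, hK⟩ := isCompact_Icc.exists_bound_of_continuousOn hKc
  intro t ht
  refine sub_eq_zero.1 (eq_zero_of_abs_deriv_le_mul_abs_self_of_eq_zero_right (K := K)
    (hyc.sub hzc) (fun s hs ↦ (((hy s (Ico_subset_Icc_self hs)).sub
      (hz s (Ico_subset_Icc_self hs))).mono (Icc_subset_Icc_left hs.1)).mono_of_mem_nhdsWithin
      (Icc_mem_nhdsGE hs.2)) (sub_eq_zero.2 h0) (fun s hs ↦ ?_) t ht)
  have hs' := Ico_subset_Icc_self hs
  calc _ = ‖∑ k ∈ Finset.range (n + 1), a k s * (z s ^ k - y s ^ k)‖ := by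
        simp only [mul_sub, Finset.sum_sub_distrib]
        congr 1
        ring
    _ ≤ ∑ k ∈ Finset.range (n + 1), |a k s| * (|y s - z s| * k * max |y s| |z s| ^ (k - 1)) := by
        refine (norm_sum_le _ _).trans (Finset.sum_le_sum fun k _ ↦ ?_)
        rw [norm_mul, Real.norm_eq_abs, Real.norm_eq_abs, abs_sub_comm]
        gcongr
        exact abs_pow_sub_pow_le _ _ _
    _ = (∑ k ∈ Finset.range (n + 1), |a k s| * (k * max |y s| |z s| ^ (k - 1))) *
          |y s - z s| := by
        rw [Finset.sum_mul]
        exact Finset.sum_congr rfl fun k _ ↦ by ring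
    _ ≤ K * ‖y s - z s‖ := by
        rw [Real.norm_eq_abs]
        gcongr
        exact (le_abs_self _).trans (hK s hs')

/-! ### Reduction to coefficients continuous on the line -/

theorem upperI_congr {a b : ℕ → ℝ → ℝ} {t₀ t : ℝ} (hab : ∀ k, EqOn (a k) (b k) (Ici t₀))
    (γ : ℝ) (ht : t₀ ≤ t) : upperI a t₀ γ t = upperI b t₀ γ t := by
  have key : ∀ τ, t₀ ≤ τ → ∫ s in τ..t, a 1 s = ∫ s in τ..t, b 1 s := fun τ hτ ↦
    intervalIntegral.integral_congr fun s hs ↦ hab 1 ((le_inf hτ ht).trans hs.1)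
  unfold upperI
  rw [key t₀ le_rfl]
  congr 1
  refine intervalIntegral.integral_congr fun τ hτ ↦ ?_
  rw [uIcc_of_le ht] at hτ
  simp only [key τ hτ.1, hab 0 hτ.1]

theorem theorem4p3 (n : ℕ) (hn : 2 ≤ n) (a : ℕ → ℝ → ℝ) (t₀ γ : ℝ)
    (ha : ∀ k ≤ n, ContinuousOn (a k) (Ici t₀))
    (hγ : 0 ≤ γ)
    -- condition (C)
    (hC : ∀ k, 2 ≤ k → k ≤ n → ∀ t, t₀ ≤ t → 0 ≤ a k t)
    -- condition (D)
    (N : ℕ∞) (T : ℕ → EReal) (hT : IsUsableSequence t₀ ⊤ N T)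
    (hD : ∀ l : ℕ, 1 ≤ l → ((l + 1 : ℕ) : ℕ∞) ≤ N →
      ∀ r t : ℝ, T l = (r : EReal) → r ≤ t → (t : EReal) < T (l + 1) →
        riccatiIntegral a r t ≤ 0)
    -- condition (E)
    (hE : ∀ t, t₀ ≤ t →
      ∫ τ in t₀..t,
        Real.exp (∫ s in t₀..τ,
          ((∑ k ∈ Finset.Icc 2 n, a k s * upperI a t₀ γ s ^ (k - 1)) + a 1 s)) * a 0 τ ≤ 0) :
    -- there is a solution on the whole half-line with initial value `γ`
    (∃ y : ℝ → ℝ, IsPolySolutionOn n a (Ici t₀) y ∧ y t₀ = γ) ∧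
    -- every solution with initial value `γ`, on any interval `J` that starts at `t₀`, continues to
    -- a solution on the whole half-line, which lies between `0` and `I_γ`
    (∀ (J : Set ℝ) (y : ℝ → ℝ), J.OrdConnected → J.Nontrivial → t₀ ∈ J → J ⊆ Ici t₀ →
      IsPolySolutionOn n a J y → y t₀ = γ →
      ∃ z : ℝ → ℝ, IsPolySolutionOn n a (Ici t₀) z ∧ EqOn z y J ∧
        ∀ t, t₀ ≤ t → 0 ≤ z t ∧ z t ≤ upperI a t₀ γ t) := by
  set b : ℕ → ℝ → ℝ := fun k t ↦ a k (max t t₀) with hb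
  have hab : ∀ k, EqOn (a k) (b k) (Ici t₀) := fun k t ht ↦ by
    simp only [hb, max_eq_left (mem_Ici.1 ht)]
  have hbc : ∀ k ≤ n, Continuous (b k) := fun k hk ↦
    (ha k hk).comp_continuous (by fun_prop) fun t ↦ mem_Ici.2 (le_max_right _ _)
  obtain ⟨z, hz0, hz, hzI⟩ := exists_solution_of_continuous hn (t₀ := t₀) hbc hγ
    (fun k h2 hk t _ ↦ hC k h2 hk _ (le_max_right _ _)) (fun t ht ↦ by
      refine (intervalIntegral.integral_congr fun τ hτ ↦ ?_).trans_le (hE t ht)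
      rw [uIcc_of_le ht] at hτ
      have hint : ∫ s in t₀..τ,
          ((∑ k ∈ Finset.Icc 2 n, b k s * upperI b t₀ γ s ^ (k - 1)) + b 1 s) = ∫ s in t₀..τ,
          ((∑ k ∈ Finset.Icc 2 n, a k s * upperI a t₀ γ s ^ (k - 1)) + a 1 s) := by
        refine intervalIntegral.integral_congr fun s hs ↦ ?_
        rw [uIcc_of_le hτ.1] at hs
        simp only [upperI_congr hab γ hs.1, fun k ↦ hab k hs.1]
      simp only [hint, hab 0 hτ.1])
  have hza : IsPolySolutionOn n a (Ici t₀) z := fun t ht ↦ by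
    simpa only [fun k ↦ hab k ht] using hz t ht
  refine ⟨⟨z, hza, hz0⟩, fun J y hJ _ h0J hJt hy hy0 ↦ ⟨z, hza, fun t ht ↦ ?_, fun t ht ↦ ?_⟩⟩
  · have htt : t₀ ≤ t := hJt ht
    exact IsPolySolutionOn.eqOn_Icc (fun k hk ↦ (ha k hk).mono Icc_subset_Ici_self)
      (hza.mono Icc_subset_Ici_self) (hy.mono (hJ.out h0J ht)) (hz0.trans hy0.symm)
      (right_mem_Icc.2 htt)
  · rw [upperI_congr hab γ ht]
    exact hzI t ht
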